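/- Let $G$ be a second countable locally compact group acting continuously on a nonempty compact metrizable space $X$, let $\mu$ be a Borel probability measure on $G$, and let $E$ be a finite-dimensional normed real vector space. A Borel probability measure $\nu$ on $X$ is called $\mu$-stationary if $\mu*\nu=\nu$, where $\mu*\nu$ is the image of $\mu\otimes\nu$ under $(g,x)\mapsto gx$. Symmetric $2$-tensors of $E$ are identified with quadratic forms on the dual space $E^*$, and for $v\in E$ one writes $v^2:=v\otimes v$, that is, the quadratic form $f\mapsto f(v)^2$. Let $\sigma:G\times X\to E$ be a continuous cocycle, i.e. a continuous function with $\sigma(gg',x)=\sigma(g,g'x)+\sigma(g',x)$ for all $g,g'\in G$, $x\in X$, and assume that $$\int_G \sigma_{\sup}(g)^2\,d\mu(g)<\infty,\qquad \text{where } \sigma_{\sup}(g)=\sup_{x\in X}\|\sigma(g,x)\|.$$ Assume that $\sigma$ is centerable with average $\sigma_\mu\in E$ and has the unique covariance $\Phi_\mu\in \mathrm S^2E$. This means that one can write $$\sigma(g,x)=\sigma_0(g,x)+\varphi(x)-\varphi(gx)\qquad (g\in G,\ x\in X),$$ where $\varphi:X\to E$ is continuous and $\sigma_0$ is a cocycle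 with constant drift $\sigma_\mu$, i.e. $\int_G\sigma_0(g,x)\,d\mu(g)=\sigma_\mu$ for all $x\in X$, and such that $$\int_{G\times X}\bigl(\sigma_0(g,x)-\sigma_\mu\bigr)^2\,d\mu(g)\,d\nu(x)=\Phi_\mu\qquad\text{for every $\mu$-stationary Borel probability measure $\nu$ on $X$.}$$ Then there is a centered Gaussian law $N_\mu$ on $E$ (possibly degenerate) with covariance $2$-tensor $\Phi_\mu$, i.e. with $\int_E v^2\,dN_\mu(v)=\Phi_\mu$, and for every bounded continuous function $\psi:E\to\mathbb R$ one has, uniformly for $x\in X$, $$\int_G\psi\!\left(\frac{\sigma(g,x)-n\sigma_\mu}{\sqrt n}\right)d\mu^{*n}(g)\ \xrightarrow[n\to\infty]{}\ \int_E\psi(v)\,dN_\mu(v),$$ where $\mu^{*n}$ is the $n$-th convolution power of $\mu$. -/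

import Mathlib

open MeasureTheory ProbabilityTheory Filter Topology
open scoped BoundedContinuousFunction

namespace CocycleCLT

section Walk

variable {G X : Type*} [Group G] [MeasurableSpace G]

/-- The convolution power `μ^{*n}` of a measure on a group; `μ^{*0}` is the unit mass at `1`. -/
noncomputable def convPow (μ : Measure G) : ℕ → Measure G
  | 0 => Measure.dirac 1
  | n + 1 => Measure.mconv μ (convPow μ n)

/-- The measure `ν` on the `G`-space `X` is a `μ`-stationary probability measure: it has total mass
one and `μ * ν = ν`, where `μ * ν` is the image of `μ ⊗ ν` under the action map. -/
structure IsStationary [MulAction G X] [MeasurableSpace X]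
    (μ : Measure G) (ν : Measure X) : Prop where
  isProbabilityMeasure : IsProbabilityMeasure ν
  map_smul_eq : (μ.prod ν).map (fun p : G × X => p.1 • p.2) = ν

end Walk

section Cocycle

variable {G X E : Type*} [Group G] [MulAction G X] [NormedAddCommGroup E] [NormedSpace ℝ E]

/-- The cocycle relation `σ(gg', x) = σ(g, g'x) + σ(g', x)`. -/
def IsCocycle (σ : G × X → E) : Prop :=
  ∀ (g g' : G) (x : X), σ (g * g', x) = σ (g, g' • x) + σ (g', x)

/-- The sup-norm function `σ_sup(g) = sup_x ‖σ(g, x)‖`. -/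
noncomputable def supNorm (σ : G × X → E) (g : G) : ℝ := ⨆ x : X, ‖σ (g, x)‖

/-- `σ(g, x) = σ₀(g, x) + ψ(x) - ψ(gx)`, where `σ₀` is a cocycle with constant drift `m` and `ψ` is
a continuous function. The function `σ` is centerable with average `m` when such `σ₀`, `ψ` exist. -/
structure IsCentering [TopologicalSpace X] [MeasurableSpace G]
    (μ : Measure G) (σ σ₀ : G × X → E) (ψ : X → E) (m : E) : Prop where
  isCocycle : IsCocycle σ₀
  drift_eq : ∀ x : X, ∫ g, σ₀ (g, x) ∂μ = m
  continuous_transfer : Continuous ψ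
  eq_add_coboundary : ∀ (g : G) (x : X), σ (g, x) = σ₀ (g, x) + (ψ x - ψ (g • x))

end Cocycle

section Gaussian

variable {Ω E : Type*} [MeasurableSpace Ω] [NormedAddCommGroup E] [NormedSpace ℝ E]

/-- The equality `Φ = ∫ Y² dρ` of symmetric `2`-tensors of `E`. A symmetric `2`-tensor of `E` is
regarded as a quadratic form on the dual of `E`; thus `v² = v ⊗ v` is the form `f ↦ (f v)²`. -/
def HasSecondMoment (ρ : Measure Ω) (Y : Ω → E) (Φ : QuadraticForm ℝ (StrongDual ℝ E)) : Prop :=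
  ∀ f : StrongDual ℝ E, Integrable (fun ω => f (Y ω) ^ 2) ρ ∧ ∫ ω, f (Y ω) ^ 2 ∂ρ = Φ f

/-- `N` is the centered Gaussian law `N_Φ` on `E` with covariance `2`-tensor `Φ = ∫ v² dN(v)`. -/
structure IsGaussianLaw [MeasurableSpace E] (N : Measure E)
    (Φ : QuadraticForm ℝ (StrongDual ℝ E)) : Prop where
  isGaussian : IsGaussian N
  mean_eq_zero : ∫ v, v ∂N = 0
  covariance_eq : HasSecondMoment N (fun v : E => v) Φ

end Gaussian

section Centerable

variable {G X E : Type*} [Group G] [MulAction G X] [TopologicalSpace X] [MeasurableSpace G]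
  [MeasurableSpace X] [NormedAddCommGroup E] [NormedSpace ℝ E]

/-- The function `σ` is centerable with average `m` and has the unique covariance `Φ`: with
`σ₀` as in the definition of centerability, `∫ (σ₀(g, x) - m)² dμ(g) dν(x) = Φ` for every
`μ`-stationary probability measure `ν` on `X`. -/
def IsCenterableWithUniqueCovariance (μ : Measure G) (σ : G × X → E) (m : E)
    (Φ : QuadraticForm ℝ (StrongDual ℝ E)) : Prop :=
  ∃ (σ₀ : G × X → E) (ψ : X → E), IsCentering μ σ σ₀ ψ m ∧
    ∀ ν : Measure X, IsStationary μ ν → HasSecondMoment (μ.prod ν) (fun p => σ₀ p - m) Φ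

end Centerable

end CocycleCLT

/-! Characteristic functions reduce the claim to scalar cocycles s = f ∘ σ₀ with f in the dual: the
coboundary is bounded, so division by √n kills it. Put α = f m, V = Φ f, let P be the Markov
operator and v(x) = ∫ (s(g, x) - α)² dμ(g). Up to a phase, the characteristic function at time n is
the n-th iterate of the average twisted by exp(i t s), applied to 1, with t = 1/√n. The constant
drift removes the linear term of the expansion. Hence, if a - P a = (V - v)/2, then 1 + t² a is an
eigenfunction up to o(t²), with eigenvalue exp(i t α)(1 - t² V/2)
(`norm_twistedAverage_exp_sub_le`). Twisted averages are contractions, so n iterations cost only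
n·o(t²) = o(1) (`norm_twistedAverage_convPow_sub_le`), and (1 - V/(2n))^n tends to exp(-V/2).

The unique covariance says that every stationary measure gives v the integral V. Limit points of the
empirical measures are stationary, so the Cesàro means of v converge uniformly to V, and the Poisson
equation is solvable up to any ε in sup norm (`exists_approx_poisson`). An error ε t² per step adds
up to ε.

Uniformity in x is encoded as convergence along `atTop ×ˢ ⊤` on ℕ × X, to which Lévy's theorem
applies (`tendsto_integral_of_tendsto_charFunDual`). -/

namespace CocycleCLT

/-! ### Convolution powers -/

section Convolution

variable {G : Type*} [Group G] [MeasurableSpace G] [MeasurableMul₂ G]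

instance isProbabilityMeasure_convPow (μ : Measure G) [IsProbabilityMeasure μ] (n : ℕ) :
    IsProbabilityMeasure (convPow μ n) := by
  induction n with
  | zero => exact Measure.dirac.isProbabilityMeasure
  | succ n ih =>
    have := ih
    exact Measure.isProbabilityMeasure_map (by fun_prop)

/-- Integration of a bounded function against `μ^{*(n+1)}`. -/
lemma integral_convPow_succ {F : Type*} [NormedAddCommGroup F] [NormedSpace ℝ F]
    (μ : Measure G) [IsProbabilityMeasure μ] (n : ℕ) {f : G → F} (hf : StronglyMeasurable f)
    {C : ℝ} (hC : ∀ g, ‖f g‖ ≤ C) :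
    ∫ g, f g ∂(convPow μ (n + 1)) = ∫ g', ∫ g, f (g * g') ∂μ ∂(convPow μ n) := by
  have hint : Integrable (fun p : G × G => f (p.1 * p.2)) (μ.prod (convPow μ n)) :=
    Integrable.of_bound (hf.comp_measurable measurable_mul).aestronglyMeasurable C
      (ae_of_all _ fun _ => hC _)
  rw [convPow, Measure.mconv, integral_map (by fun_prop) hf.aestronglyMeasurable,
    integral_prod_symm _ hint]

end Convolution

/-! ### Twisted averaging operators and approximate eigenfunctions -/

section TwistedAverage

variable {G X 𝕜 : Type*} [Group G] [TopologicalSpace G] [IsTopologicalGroup G]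
  [SecondCountableTopology G] [MeasurableSpace G] [BorelSpace G] [MulAction G X] [RCLike 𝕜]

/-- The average of `u` over the action, with respect to `κ` and twisted by the weight `χ`. -/
noncomputable def twistedAverage (κ : Measure G) (χ : G × X → 𝕜) (u : X → 𝕜) (x : X) : 𝕜 :=
  ∫ g, χ (g, x) * u (g • x) ∂κ

-- Contraction in sup norm: this is what keeps errors from being amplified under iteration.
omit [TopologicalSpace G] [IsTopologicalGroup G] [SecondCountableTopology G] [BorelSpace G] in
lemma norm_twistedAverage_le (κ : Measure G) [IsProbabilityMeasure κ] {χ : G × X → 𝕜}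
    (hχ : ∀ p, ‖χ p‖ ≤ 1) {u : X → 𝕜} {C : ℝ} (hu : ∀ x, ‖u x‖ ≤ C) (x : X) :
    ‖twistedAverage κ χ u x‖ ≤ C := by
  have h : ∀ g, ‖χ (g, x) * u (g • x)‖ ≤ C := fun g => by
    rw [norm_mul]
    nlinarith [hχ (g, x), hu (g • x), norm_nonneg (χ (g, x)), norm_nonneg (u (g • x))]
  simpa [twistedAverage] using norm_integral_le_of_norm_le_const (μ := κ) (ae_of_all _ h)

variable [TopologicalSpace X] [CompactSpace X] [ContinuousSMul G X]

omit [IsTopologicalGroup G] [SecondCountableTopology G] in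
lemma integrable_twisted (κ : Measure G) [IsProbabilityMeasure κ] {χ : G × X → 𝕜}
    (hχc : Continuous χ) (hχ : ∀ p, ‖χ p‖ ≤ 1) {u : X → 𝕜} (hu : Continuous u) (x : X) :
    Integrable (fun g => χ (g, x) * u (g • x)) κ := by
  obtain ⟨C, hC⟩ := isCompact_univ.exists_bound_of_continuousOn hu.continuousOn
  refine Integrable.of_bound (C := C) ?_ (ae_of_all _ fun g => ?_)
  · have : Continuous fun g : G => χ (g, x) * u (g • x) := by fun_prop
    exact this.stronglyMeasurable.aestronglyMeasurable
  · rw [norm_mul]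
    nlinarith [hχ (g, x), hC (g • x) trivial, norm_nonneg (χ (g, x)), norm_nonneg (u (g • x))]

omit [IsTopologicalGroup G] [SecondCountableTopology G] in
lemma continuous_twistedAverage [FirstCountableTopology X] (κ : Measure G)
    [IsProbabilityMeasure κ] {χ : G × X → 𝕜}
    (hχc : Continuous χ) (hχ : ∀ p, ‖χ p‖ ≤ 1) {u : X → 𝕜} (hu : Continuous u) :
    Continuous (twistedAverage κ χ u) := by
  obtain ⟨C, hC⟩ := isCompact_univ.exists_bound_of_continuousOn hu.continuousOn
  refine continuous_of_dominated (bound := fun _ => C)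
    (fun x => (integrable_twisted κ hχc hχ hu x).aestronglyMeasurable)
    (fun x => ae_of_all _ fun g => ?_) (integrable_const _) (ae_of_all _ fun g => by fun_prop)
  rw [norm_mul]
  nlinarith [hχ (g, x), hC (g • x) trivial, norm_nonneg (χ (g, x)), norm_nonneg (u (g • x))]

omit [IsTopologicalGroup G] [SecondCountableTopology G] in
lemma twistedAverage_sub (κ : Measure G) [IsProbabilityMeasure κ] {χ : G × X → 𝕜}
    (hχc : Continuous χ) (hχ : ∀ p, ‖χ p‖ ≤ 1) {u v : X → 𝕜} (hu : Continuous u)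
    (hv : Continuous v) (c : 𝕜) (x : X) :
    twistedAverage κ χ (fun y => u y - c * v y) x =
      twistedAverage κ χ u x - c * twistedAverage κ χ v x := by
  simp only [twistedAverage]
  rw [← integral_const_mul, ← integral_sub (integrable_twisted κ hχc hχ hu x)
    ((integrable_twisted κ hχc hχ hv x).const_mul c)]
  congr 1 with g
  ring

variable (μ : Measure G) [IsProbabilityMeasure μ]

/-- For a multiplicative cocycle `χ`, the twisted average along `μ^{*(n+1)}` is the twisted average
along `μ^{*n}` of the twisted average along `μ`. -/
lemma twistedAverage_convPow_succ {χ : G × X → 𝕜}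
    (hχc : Continuous χ) (hχ : ∀ p, ‖χ p‖ ≤ 1)
    (hmul : ∀ (g g' : G) (x : X), χ (g * g', x) = χ (g, g' • x) * χ (g', x))
    {u : X → 𝕜} (hu : Continuous u) (n : ℕ) (x : X) :
    twistedAverage (convPow μ (n + 1)) χ u x =
      twistedAverage (convPow μ n) χ (twistedAverage μ χ u) x := by
  obtain ⟨C, hC⟩ := isCompact_univ.exists_bound_of_continuousOn hu.continuousOn
  have hcont : Continuous fun g : G => χ (g, x) * u (g • x) := by fun_prop
  simp only [twistedAverage]
  rw [integral_convPow_succ μ n hcont.stronglyMeasurable (C := C) fun g => ?_]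
  · congr 1 with g'
    -- The factor χ(g', x) does not depend on the inner variable g; once it is taken out, the inner
    -- integral is the μ-average of u at g'x.
    rw [← integral_const_mul]
    congr 1 with g
    rw [hmul, mul_smul]
    ring
  · rw [norm_mul]
    nlinarith [hχ (g, x), hC (g • x) trivial, norm_nonneg (χ (g, x)), norm_nonneg (u (g • x))]

/-- If `u` is an approximate eigenfunction of the twisted average along `μ`, then it is one of the
twisted average along `μ^{*n}`, with an error that grows linearly. -/
lemma norm_twistedAverage_convPow_sub_le [FirstCountableTopology X] {χ : G × X → 𝕜}
    (hχc : Continuous χ) (hχ : ∀ p, ‖χ p‖ ≤ 1)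
    (hmul : ∀ (g g' : G) (x : X), χ (g * g', x) = χ (g, g' • x) * χ (g', x))
    (hone : ∀ x, χ (1, x) = 1)
    {u : X → 𝕜} (hu : Continuous u) {c : 𝕜} (hc : ‖c‖ ≤ 1) {δ : ℝ}
    (h : ∀ x, ‖twistedAverage μ χ u x - c * u x‖ ≤ δ) (n : ℕ) (x : X) :
    ‖twistedAverage (convPow μ n) χ u x - c ^ n * u x‖ ≤ n * δ := by
  induction n with
  | zero =>
    have hcont : Continuous fun g : G => χ (g, x) * u (g • x) := by fun_prop
    simp only [twistedAverage, convPow]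
    rw [integral_dirac' _ _ hcont.stronglyMeasurable]
    simp [hone]
  | succ n ih =>
    have hv := continuous_twistedAverage μ hχc hχ hu
    -- The first term is the one-step defect, bounded by δ through contraction; the second is the
    -- induction hypothesis multiplied by c.
    have key : twistedAverage (convPow μ (n + 1)) χ u x - c ^ (n + 1) * u x =
        twistedAverage (convPow μ n) χ (fun y => twistedAverage μ χ u y - c * u y) x +
          c * (twistedAverage (convPow μ n) χ u x - c ^ n * u x) := by
      rw [twistedAverage_convPow_succ μ hχc hχ hmul hu, twistedAverage_sub _ hχc hχ hv hu]
      ring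
    rw [key]
    calc _ ≤ δ + 1 * (n * δ) := by
          refine (norm_add_le _ _).trans (add_le_add (norm_twistedAverage_le _ hχ h x) ?_)
          rw [norm_mul]
          exact mul_le_mul hc ih (norm_nonneg _) zero_le_one
      _ = _ := by push_cast; ring

end TwistedAverage

/-! ### Stationary measures, uniform Cesàro convergence, the Poisson equation -/

section Stationary

variable {G X : Type*} [Group G] [TopologicalSpace G] [IsTopologicalGroup G]
  [SecondCountableTopology G] [MeasurableSpace G] [BorelSpace G]
  [TopologicalSpace X] [CompactSpace X] [TopologicalSpace.MetrizableSpace X]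
  [MulAction G X] [ContinuousSMul G X]
  (μ : Measure G) [IsProbabilityMeasure μ]

/-- The Markov operator `P u(x) = ∫ u(gx) dμ(g)` on the continuous functions. -/
noncomputable def markovOperator : Module.End ℝ C(X, ℝ) where
  toFun u := ⟨twistedAverage μ (fun _ => 1) u,
    continuous_twistedAverage μ continuous_const (by simp) u.continuous⟩
  map_add' u v := by
    ext x
    -- The constant -1 turns the difference formula into additivity.
    have := twistedAverage_sub μ (𝕜 := ℝ) (χ := fun _ => 1) continuous_const (by simp)
      u.continuous v.continuous (-1) x
    simp only [neg_mul, one_mul, sub_neg_eq_add] at this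
    exact this
  map_smul' c u := by
    ext x
    simp [twistedAverage, integral_const_mul]

omit [IsTopologicalGroup G] [SecondCountableTopology G] in
lemma markovOperator_apply (u : C(X, ℝ)) (x : X) :
    markovOperator μ u x = ∫ g, u (g • x) ∂μ := by
  simp [markovOperator, twistedAverage]

lemma markovOperator_pow_apply (k : ℕ) (u : C(X, ℝ)) (x : X) :
    (markovOperator μ ^ k) u x = ∫ g, u (g • x) ∂(convPow μ k) := by
  induction k generalizing u with
  | zero =>
    have : Continuous fun g : G => u (g • x) := by fun_prop
    rw [convPow, integral_dirac' _ _ this.stronglyMeasurable]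
    simp
  | succ k ih =>
    have := twistedAverage_convPow_succ μ (𝕜 := ℝ) (χ := fun _ => 1) continuous_const (by simp)
      (by simp) u.continuous k x
    rw [pow_succ, Module.End.mul_apply, ih]
    simpa [twistedAverage, markovOperator_apply] using this.symm

lemma abs_markovOperator_pow_le (k : ℕ) (u : C(X, ℝ)) (x : X) :
    |(markovOperator μ ^ k) u x| ≤ ‖u‖ := by
  rw [markovOperator_pow_apply]
  simpa using norm_integral_le_of_norm_le_const (μ := convPow μ k)
    (ae_of_all _ fun g => u.norm_coe_le_norm (g • x))

/-- The mean over `k ≤ n` of the laws of the positions at time `k` of the walk starting at `x`. -/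
noncomputable def empiricalMeasure [MeasurableSpace X] (n : ℕ) (x : X) : Measure X :=
  ENNReal.ofReal ((n + 1 : ℝ)⁻¹) •
    ∑ k ∈ Finset.range (n + 1), (convPow μ k).map (fun g : G => g • x)

variable [MeasurableSpace X] [BorelSpace X]

instance isProbabilityMeasure_empiricalMeasure (n : ℕ) (x : X) :
    IsProbabilityMeasure (empiricalMeasure μ n x) := by
  constructor
  have hm : Measurable fun g : G => g • x := (by fun_prop : Continuous _).measurable
  have : ∀ k, (convPow μ k).map (fun g : G => g • x) Set.univ = 1 := fun k => by
    rw [Measure.map_apply hm .univ]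
    simp
  simp only [empiricalMeasure, Measure.smul_apply, Measure.finsetSum_apply, this]
  have h : ((n : ENNReal) + 1) = ENNReal.ofReal (n + 1) := by
    rw [ENNReal.ofReal_add (by positivity) (by positivity)]
    simp
  simp only [Finset.sum_const, Finset.card_range, nsmul_eq_mul, mul_one, smul_eq_mul,
    Nat.cast_add, Nat.cast_one]
  rw [h, ← ENNReal.ofReal_mul (by positivity), inv_mul_cancel₀ (by positivity), ENNReal.ofReal_one]

lemma integral_empiricalMeasure (u : C(X, ℝ)) (n : ℕ) (x : X) :
    ∫ y, u y ∂(empiricalMeasure μ n x) =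
      (n + 1 : ℝ)⁻¹ * ∑ k ∈ Finset.range (n + 1), (markovOperator μ ^ k) u x := by
  have hm : Measurable fun g : G => g • x := (by fun_prop : Continuous _).measurable
  have hu : StronglyMeasurable u := u.continuous.stronglyMeasurable
  rw [empiricalMeasure, integral_smul_measure, ENNReal.toReal_ofReal (by positivity), smul_eq_mul,
    integral_finsetSum_measure]
  · congr 1
    refine Finset.sum_congr rfl fun k _ => ?_
    rw [integral_map hm.aemeasurable hu.aestronglyMeasurable, markovOperator_pow_apply]
  · intro k _
    have := Measure.isProbabilityMeasure_map (μ := convPow μ k) hm.aemeasurable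
    exact Integrable.of_bound hu.aestronglyMeasurable ‖u‖ (ae_of_all _ u.norm_coe_le_norm)

/-- The sum telescopes to two boundary terms, each at most ‖u‖. This makes limits of empirical
measures stationary. -/
lemma abs_integral_empiricalMeasure_sub_le (u : C(X, ℝ)) (n : ℕ) (x : X) :
    |∫ y, (markovOperator μ u - u) y ∂(empiricalMeasure μ n x)| ≤ 2 * ‖u‖ * (1 / ((n : ℝ) + 1)) := by
  have key : ∑ k ∈ Finset.range (n + 1), (markovOperator μ ^ k) (markovOperator μ u - u) x =
      (markovOperator μ ^ (n + 1)) u x - u x := by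
    have h : ∀ k, (markovOperator μ ^ k) (markovOperator μ u - u) x =
        (markovOperator μ ^ (k + 1)) u x - (markovOperator μ ^ k) u x := fun k => by
      rw [map_sub, pow_succ]
      rfl
    rw [Finset.sum_congr rfl fun k _ => h k,
      Finset.sum_range_sub fun k => (markovOperator μ ^ k) u x]
    simp
  rw [integral_empiricalMeasure, key, abs_mul, abs_of_nonneg (by positivity : (0 : ℝ) ≤ _),
    one_div, mul_comm]
  have h1 := abs_markovOperator_pow_le μ (n + 1) u x
  have h2 : |u x| ≤ ‖u‖ := u.norm_coe_le_norm x
  refine mul_le_mul_of_nonneg_right ?_ (by positivity)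
  linarith [abs_sub ((markovOperator μ ^ (n + 1)) u x) (u x)]

omit [IsTopologicalGroup G] in
/-- A probability measure that the Markov operator preserves is stationary. -/
lemma isStationary_of_integral_markovOperator (ν : Measure X) [IsProbabilityMeasure ν]
    (h : ∀ u : C(X, ℝ), ∫ x, markovOperator μ u x ∂ν = ∫ x, u x ∂ν) : IsStationary μ ν := by
  let _ := TopologicalSpace.metrizableSpaceMetric X
  have hm : Measurable fun p : G × X => p.1 • p.2 := (by fun_prop : Continuous _).measurable
  have := Measure.isProbabilityMeasure_map (μ := μ.prod ν) hm.aemeasurable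
  refine ⟨inferInstance, ext_of_forall_integral_eq_of_IsFiniteMeasure fun f => ?_⟩
  have hf : StronglyMeasurable f := f.continuous.stronglyMeasurable
  rw [integral_map hm.aemeasurable hf.aestronglyMeasurable, integral_prod_symm]
  · have := h f.toContinuousMap
    simpa [markovOperator_apply] using this
  · exact Integrable.of_bound (hf.comp_measurable hm).aestronglyMeasurable ‖f‖
      (ae_of_all _ fun _ => f.norm_coe_le_norm _)

/-- Limit points of the empirical measures exist and are stationary. -/
lemma exists_isStationary_tendsto (U : Ultrafilter (ℕ × X))
    (hU : (U : Filter (ℕ × X)) ≤ atTop ×ˢ ⊤) :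
    ∃ ν : Measure X, IsStationary μ ν ∧ ∀ u : C(X, ℝ),
      Tendsto (fun q : ℕ × X => ∫ y, u y ∂(empiricalMeasure μ q.1 q.2)) U (𝓝 (∫ y, u y ∂ν)) := by
  let e : ℕ × X → ProbabilityMeasure X := fun q => ⟨empiricalMeasure μ q.1 q.2, inferInstance⟩
  -- The probability measures on a compact metrizable space form a compact space.
  obtain ⟨ν, -, hν⟩ := isCompact_univ.ultrafilter_le_nhds (U.map e) (by simp)
  have hlim : ∀ u : C(X, ℝ), Tendsto
      (fun q : ℕ × X => ∫ y, u y ∂(empiricalMeasure μ q.1 q.2)) U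
      (𝓝 (∫ y, u y ∂(ν : Measure X))) := fun u =>
    ProbabilityMeasure.tendsto_iff_forall_integral_tendsto.1 (show Tendsto e U (𝓝 ν) from hν)
      (BoundedContinuousFunction.mkOfCompact u)
  refine ⟨ν, isStationary_of_integral_markovOperator μ _ fun u => ?_, hlim⟩
  have h0 : Tendsto (fun q : ℕ × X =>
      ∫ y, (markovOperator μ u - u) y ∂(empiricalMeasure μ q.1 q.2)) U (𝓝 0) := by
    have hfst : Tendsto (fun q : ℕ × X => q.1) U atTop := tendsto_fst.mono_left hU
    have hb := ((tendsto_one_div_add_atTop_nhds_zero_nat (𝕜 := ℝ)).comp hfst).const_mul (2 * ‖u‖)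
    rw [mul_zero] at hb
    exact squeeze_zero_norm (fun q => abs_integral_empiricalMeasure_sub_le μ u q.1 q.2) hb
  have h1 := tendsto_nhds_unique (hlim (markovOperator μ u - u)) h0
  have hi : ∀ v : C(X, ℝ), Integrable v (ν : Measure X) := fun v =>
    Integrable.of_bound v.continuous.stronglyMeasurable.aestronglyMeasurable ‖v‖
      (ae_of_all _ v.norm_coe_le_norm)
  have h2 := integral_sub (hi (markovOperator μ u)) (hi u)
  simp only [ContinuousMap.sub_apply] at h1
  linarith

/-- Nonemptiness of X makes `atTop ×ˢ ⊤` a proper filter. Existence is what later forces the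
variance and Φ to be nonnegative. -/
lemma exists_isStationary [Nonempty X] : ∃ ν : Measure X, IsStationary μ ν := by
  obtain ⟨U, hU⟩ := Ultrafilter.exists_le ((atTop : Filter ℕ) ×ˢ (⊤ : Filter X))
  obtain ⟨ν, hν, -⟩ := exists_isStationary_tendsto μ U hU
  exact ⟨ν, hν⟩

/-- If all stationary probability measures give the same integral to `u`, then the Cesàro means of
`u` along the walk converge uniformly. -/
lemma tendsto_cesaro (u : C(X, ℝ)) (c : ℝ)
    (h : ∀ ν : Measure X, IsStationary μ ν → ∫ x, u x ∂ν = c) :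
    Tendsto (fun q : ℕ × X => ((q.1 : ℝ) + 1)⁻¹ *
      ∑ k ∈ Finset.range (q.1 + 1), (markovOperator μ ^ k) u q.2) (atTop ×ˢ ⊤) (𝓝 c) := by
  -- On an ultrafilter the starting point moves together with n, so compactness yields uniformity in
  -- x directly.
  rw [tendsto_iff_ultrafilter]
  intro U hU
  obtain ⟨ν, hν, hlim⟩ := exists_isStationary_tendsto μ U hU
  simpa only [integral_empiricalMeasure, h ν hν] using hlim u

/-- If all stationary probability measures give the same integral `c` to `u`, then the Poisson
equation `a - P a = u - c` has approximate continuous solutions. -/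
lemma exists_approx_poisson (u : C(X, ℝ)) (c : ℝ)
    (h : ∀ ν : Measure X, IsStationary μ ν → ∫ x, u x ∂ν = c) {ε : ℝ} (hε : 0 < ε) :
    ∃ a : C(X, ℝ), ∀ x, |a x - markovOperator μ a x - (u x - c)| ≤ ε := by
  have hev := (tendsto_cesaro μ u c h).eventually (Metric.ball_mem_nhds c hε)
  obtain ⟨n, hn⟩ := hev.curry.exists
  set P := markovOperator (X := X) μ
  have hP : ∀ j, (1 - P) ((∑ i ∈ Finset.range j, P ^ i) u) = u - (P ^ j) u := fun j => by
    rw [← Module.End.mul_apply, mul_neg_geom_sum]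
    rfl
  -- An average of truncated Neumann series for (1 - P)⁻¹: since 1 - P sends the j-th one to u - P^j
  -- u, it sends the average to u minus its Cesàro mean, which is within ε of u - c.
  refine ⟨((n : ℝ) + 1)⁻¹ • ∑ j ∈ Finset.range (n + 1), (∑ i ∈ Finset.range j, P ^ i) u,
    fun x => ?_⟩
  have h1 : (1 - P) (((n : ℝ) + 1)⁻¹ • ∑ j ∈ Finset.range (n + 1), (∑ i ∈ Finset.range j, P ^ i) u)
      = u - ((n : ℝ) + 1)⁻¹ • ∑ j ∈ Finset.range (n + 1), (P ^ j) u := by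
    rw [map_smul, map_sum, Finset.sum_congr rfl fun j _ => hP j, Finset.sum_sub_distrib, smul_sub]
    congr 1
    rw [Finset.sum_const, Finset.card_range, ← Nat.cast_smul_eq_nsmul ℝ, smul_smul]
    push_cast
    rw [inv_mul_cancel₀ (by positivity), one_smul]
  have h2 := congrArg (fun f : C(X, ℝ) => f x) h1
  have h3 := eventually_top.1 hn x
  rw [Real.dist_eq, abs_sub_comm] at h3
  refine le_trans (le_of_eq ?_) h3.le
  congr 1
  have h4 : ∀ f : C(X, ℝ), ((1 - P) f) x = f x - P f x := fun f => rfl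
  simp only [h4] at h2
  rw [h2, ContinuousMap.sub_apply, ContinuousMap.smul_apply, ContinuousMap.sum_apply, smul_eq_mul]
  ring

end Stationary

/-! ### Second order expansion of characteristic functions -/

section Expansion

/-- The second order Taylor remainder of the exponential on the imaginary axis. -/
lemma norm_exp_mul_I_sub_taylor_le (u : ℝ) :
    ‖Complex.exp (u * Complex.I) - (1 + u * Complex.I - (u : ℂ) ^ 2 / 2)‖ ≤
      4 * (u ^ 2 * min 1 |u|) := by
  have hn : ‖(u : ℂ) * Complex.I‖ = |u| := by simp
  rcases le_total |u| 1 with h | h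
  · rw [min_eq_right h]
    have := Complex.exp_bound (x := u * Complex.I) (by rwa [hn]) (n := 3) (by norm_num)
    rw [hn] at this
    have e : ∑ m ∈ Finset.range 3, ((u : ℂ) * Complex.I) ^ m / (m.factorial : ℂ) =
        1 + u * Complex.I - (u : ℂ) ^ 2 / 2 := by
      simp [Finset.sum_range_succ, mul_pow]
      ring
    rw [e] at this
    refine this.trans ?_
    have h3 : |u| ^ 3 = u ^ 2 * |u| := by rw [pow_succ, sq_abs]
    rw [h3]
    have : 0 ≤ u ^ 2 * |u| := by positivity
    norm_num [Nat.factorial]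
    linarith
  -- For |u| ≥ 1 the crude bound 1 + 1 + |u| + u²/2 ≤ 4u² suffices; it fixes the constant 4.
  · rw [min_eq_left h]
    have h1 : ‖Complex.exp (u * Complex.I)‖ = 1 := Complex.norm_exp_ofReal_mul_I u
    have h2 : ‖(u : ℂ) ^ 2 / 2‖ = u ^ 2 / 2 := by simp
    have h3 : ‖1 + (u : ℂ) * Complex.I - (u : ℂ) ^ 2 / 2‖ ≤ 1 + |u| + u ^ 2 / 2 := by
      refine (norm_sub_le _ _).trans (add_le_add ((norm_add_le _ _).trans ?_) h2.le)
      rw [hn, norm_one]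
    have h4 : |u| ≤ u ^ 2 := by rw [← sq_abs]; nlinarith
    refine (norm_sub_le _ _).trans ?_
    rw [h1]
    linarith

variable {Ω : Type*} [MeasurableSpace Ω] {μ : Measure Ω} [IsProbabilityMeasure μ]

/-- The integrated truncated second moment that controls second order expansions. -/
noncomputable def truncatedMoment (μ : Measure Ω) (h : Ω → ℝ) (t : ℝ) : ℝ :=
  ∫ ω, h ω ^ 2 * min 1 (|t| * h ω) ∂μ

omit [IsProbabilityMeasure μ] in
lemma integrable_truncatedMoment {h : Ω → ℝ} (hh : MemLp h 2 μ) (h0 : ∀ ω, 0 ≤ h ω) (t : ℝ) :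
    Integrable (fun ω => h ω ^ 2 * min 1 (|t| * h ω)) μ := by
  refine hh.integrable_sq.mono' ?_ (ae_of_all _ fun ω => ?_)
  · exact (hh.aestronglyMeasurable.pow 2).mul
      (aestronglyMeasurable_const.inf (hh.aestronglyMeasurable.const_mul _))
  · have h1 : 0 ≤ min 1 (|t| * h ω) := le_min zero_le_one (mul_nonneg (abs_nonneg _) (h0 ω))
    rw [Real.norm_of_nonneg (mul_nonneg (sq_nonneg _) h1)]
    exact mul_le_of_le_one_right (sq_nonneg _) (min_le_left _ _)

-- Dominated convergence with majorant h²: the truncation by 1 makes a second moment enough where a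
-- plain cubic remainder would need a third.
omit [IsProbabilityMeasure μ] in
lemma tendsto_truncatedMoment {h : Ω → ℝ} (hh : MemLp h 2 μ) (h0 : ∀ ω, 0 ≤ h ω) {t : ℕ → ℝ}
    (ht : Tendsto t atTop (𝓝 0)) :
    Tendsto (fun n => truncatedMoment μ h (t n)) atTop (𝓝 0) := by
  have : Tendsto (fun n => truncatedMoment μ h (t n)) atTop (𝓝 (∫ _, (0 : ℝ) ∂μ)) := by
    refine tendsto_integral_of_dominated_convergence (fun ω => h ω ^ 2)
      (fun n => (integrable_truncatedMoment hh h0 (t n)).aestronglyMeasurable) hh.integrable_sq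
      (fun n => ae_of_all _ fun ω => ?_) (ae_of_all _ fun ω => ?_)
    · have h1 : 0 ≤ min 1 (|t n| * h ω) := le_min zero_le_one (mul_nonneg (abs_nonneg _) (h0 ω))
      rw [Real.norm_of_nonneg (mul_nonneg (sq_nonneg _) h1)]
      exact mul_le_of_le_one_right (sq_nonneg _) (min_le_left _ _)
    · have h1 : Tendsto (fun n => h ω ^ 2 * min 1 (|t n| * h ω)) atTop
          (𝓝 (h ω ^ 2 * min 1 (|0| * h ω))) :=
        (tendsto_const_nhds.min (ht.abs.mul_const _)).const_mul _
      simpa using h1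
  simpa using this

/-- Second order expansion of a perturbed characteristic function, for a centered variable. -/
lemma norm_integral_exp_sub_le {h Y A : Ω → ℝ} (hh : MemLp h 2 μ)
    (hY : AEStronglyMeasurable Y μ) (hYh : ∀ ω, |Y ω| ≤ h ω) (hY0 : ∫ ω, Y ω ∂μ = 0)
    (hA : AEStronglyMeasurable A μ) {M : ℝ} (hAM : ∀ ω, |A ω| ≤ M) (t : ℝ) :
    ‖∫ ω, Complex.exp (t * Y ω * Complex.I) * (1 + t ^ 2 * A ω) ∂μ -
        ((1 + t ^ 2 * ∫ ω, A ω ∂μ - t ^ 2 / 2 * ∫ ω, Y ω ^ 2 ∂μ : ℝ) : ℂ)‖ ≤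
      t ^ 2 * (4 * truncatedMoment μ h t + M * |t| * ∫ ω, h ω ∂μ) := by
  have h0 : ∀ ω, 0 ≤ h ω := fun ω => (abs_nonneg _).trans (hYh ω)
  have hYL : MemLp Y 2 μ := hh.mono hY (ae_of_all _ fun ω => by
    rw [Real.norm_eq_abs, Real.norm_eq_abs, abs_of_nonneg (h0 ω)]; exact hYh ω)
  have iY : Integrable Y μ := hYL.integrable (by norm_num)
  have ih : Integrable h μ := hh.integrable (by norm_num)
  have iA : Integrable A μ := Integrable.of_bound hA M (ae_of_all _ hAM)
  have iA1 : Integrable (fun ω => 1 + t ^ 2 * A ω) μ := (integrable_const 1).add (iA.const_mul _)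
  have iR : Integrable (fun ω => (1 + t ^ 2 * A ω - t ^ 2 / 2 * Y ω ^ 2 : ℝ)) μ :=
    iA1.sub (hYL.integrable_sq.const_mul _)
  have iRC : Integrable
      (fun ω => ((1 + t ^ 2 * A ω - t ^ 2 / 2 * Y ω ^ 2 : ℝ) : ℂ)) μ := iR.ofReal
  have iE : Integrable (fun ω => Complex.exp (t * Y ω * Complex.I) * (1 + t ^ 2 * A ω)) μ := by
    refine Integrable.of_bound (C := 1 + t ^ 2 * M) ?_ (ae_of_all _ fun ω => ?_)
    · have e1 : AEStronglyMeasurable (fun ω => Complex.exp (t * Y ω * Complex.I)) μ :=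
        (by fun_prop : Continuous fun y : ℝ => Complex.exp (t * y * Complex.I)).comp_aestronglyMeasurable hY
      have e2 : AEStronglyMeasurable (fun ω => (1 + t ^ 2 * A ω : ℂ)) μ :=
        (by fun_prop : Continuous fun y : ℝ => (1 + t ^ 2 * y : ℂ)).comp_aestronglyMeasurable hA
      exact e1.mul e2
    · have e1 : ‖Complex.exp (t * Y ω * Complex.I)‖ = 1 := by
        exact_mod_cast Complex.norm_exp_ofReal_mul_I (t * Y ω)
      rw [norm_mul, e1, one_mul]
      refine (norm_add_le _ _).trans ?_
      rw [norm_one, norm_mul, norm_pow, Complex.norm_real, Complex.norm_real, Real.norm_eq_abs,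
        Real.norm_eq_abs, sq_abs]
      gcongr
      exact hAM ω
  have iI : Integrable (fun ω => ((t * Y ω : ℝ) : ℂ) * Complex.I) μ :=
    (iY.const_mul t).ofReal.mul_const _
  have hI : ∫ ω, ((t * Y ω : ℝ) : ℂ) * Complex.I ∂μ = 0 := by
    rw [integral_mul_const, integral_complex_ofReal, integral_const_mul, hY0]
    simp
  have hR : ∫ ω, (1 + t ^ 2 * A ω - t ^ 2 / 2 * Y ω ^ 2 : ℝ) ∂μ =
      1 + t ^ 2 * ∫ ω, A ω ∂μ - t ^ 2 / 2 * ∫ ω, Y ω ^ 2 ∂μ := by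
    rw [integral_sub iA1 (hYL.integrable_sq.const_mul _),
      integral_add (integrable_const 1) (iA.const_mul _), integral_const_mul, integral_const_mul]
    simp
  -- Since Y is centered, the linear Taylor term can be inserted under the integral for free.
  have hS : ((1 + t ^ 2 * ∫ ω, A ω ∂μ - t ^ 2 / 2 * ∫ ω, Y ω ^ 2 ∂μ : ℝ) : ℂ) =
      ∫ ω, (((1 + t ^ 2 * A ω - t ^ 2 / 2 * Y ω ^ 2 : ℝ) : ℂ) + ((t * Y ω : ℝ) : ℂ) * Complex.I) ∂μ := by
    rw [integral_add iRC iI, hI, add_zero, integral_complex_ofReal, hR]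
  have iT := integrable_truncatedMoment hh h0 t
  have iS : Integrable (fun ω => ((1 + t ^ 2 * A ω - t ^ 2 / 2 * Y ω ^ 2 : ℝ) : ℂ) +
      ((t * Y ω : ℝ) : ℂ) * Complex.I) μ := iRC.add iI
  rw [hS, ← integral_sub iE iS]
  have hB : t ^ 2 * (4 * truncatedMoment μ h t + M * |t| * ∫ ω, h ω ∂μ) =
      ∫ ω, (t ^ 2 * 4 * (h ω ^ 2 * min 1 (|t| * h ω)) + t ^ 2 * M * |t| * h ω) ∂μ := by
    rw [integral_add (iT.const_mul _) (ih.const_mul _), integral_const_mul, integral_const_mul,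
      truncatedMoment]
    ring
  rw [hB]
  refine norm_integral_le_of_norm_le ((iT.const_mul _).add (ih.const_mul _))
    (ae_of_all _ fun ω => ?_)
  have h1 := norm_exp_mul_I_sub_taylor_le (t * Y ω)
  have h2 : ‖Complex.exp (((t * Y ω : ℝ) : ℂ) * Complex.I) - 1‖ ≤ |t| * h ω := by
    have := Real.norm_exp_I_mul_ofReal_sub_one_le (x := t * Y ω)
    rw [mul_comm, Real.norm_eq_abs, abs_mul] at this
    exact this.trans (mul_le_mul_of_nonneg_left (hYh ω) (abs_nonneg t))
  have h3 : ‖(t : ℂ) ^ 2 * A ω‖ ≤ t ^ 2 * M := by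
    rw [norm_mul, norm_pow, Complex.norm_real, Complex.norm_real, Real.norm_eq_abs,
      Real.norm_eq_abs, sq_abs]
    exact mul_le_mul_of_nonneg_left (hAM ω) (sq_nonneg t)
  have h4 : (t * Y ω) ^ 2 * min 1 |t * Y ω| ≤ t ^ 2 * (h ω ^ 2 * min 1 (|t| * h ω)) := by
    rw [mul_pow, mul_assoc, abs_mul, ← sq_abs (Y ω)]
    have := hYh ω
    gcongr
  -- Taylor remainder of the exponential, plus a cross term of order t³.
  have e : Complex.exp (t * Y ω * Complex.I) * (1 + t ^ 2 * A ω) -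
      (((1 + t ^ 2 * A ω - t ^ 2 / 2 * Y ω ^ 2 : ℝ) : ℂ) + ((t * Y ω : ℝ) : ℂ) * Complex.I) =
      (Complex.exp (((t * Y ω : ℝ) : ℂ) * Complex.I) -
        (1 + ((t * Y ω : ℝ) : ℂ) * Complex.I - ((t * Y ω : ℝ) : ℂ) ^ 2 / 2)) +
      (Complex.exp (((t * Y ω : ℝ) : ℂ) * Complex.I) - 1) * (t ^ 2 * A ω) := by
    push_cast
    ring
  rw [e]
  refine (norm_add_le _ _).trans (add_le_add (h1.trans (by linarith)) ?_)
  rw [norm_mul]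
  calc _ ≤ (|t| * h ω) * (t ^ 2 * M) :=
        mul_le_mul h2 h3 (norm_nonneg _) (mul_nonneg (abs_nonneg _) (h0 ω))
    _ = _ := by ring

end Expansion

/-! ### The central limit theorem for scalar cocycles -/

section ScalarCocycle

variable {G X : Type*} [Group G] [TopologicalSpace G] [IsTopologicalGroup G]
  [SecondCountableTopology G] [MeasurableSpace G] [BorelSpace G]
  [TopologicalSpace X] [CompactSpace X] [TopologicalSpace.MetrizableSpace X]
  [MulAction G X] [ContinuousSMul G X]
  {μ : Measure G} [IsProbabilityMeasure μ]

omit [IsTopologicalGroup G] [SecondCountableTopology G] in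
/-- The perturbation `1 + t² a` is an approximate eigenfunction of the average twisted by
`exp(i t s)`, as soon as `a` is an approximate solution of the Poisson equation. -/
lemma norm_twistedAverage_exp_sub_le {s : G × X → ℝ} (hs : Continuous s) {α : ℝ} {h : G → ℝ}
    (hh : MemLp h 2 μ) (hsh : ∀ g x, |s (g, x) - α| ≤ h g)
    (hdrift : ∀ x, ∫ g, s (g, x) ∂μ = α) {V ε : ℝ} (hV : 0 ≤ V) (a : C(X, ℝ))
    (ha : ∀ x, |a x - markovOperator μ a x - (-(∫ g, (s (g, x) - α) ^ 2 ∂μ) / 2 - -V / 2)| ≤ ε)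
    (t : ℝ) (x : X) :
    ‖twistedAverage μ (fun p => Complex.exp (t * s p * Complex.I))
          (fun y => 1 + (t : ℂ) ^ 2 * a y) x -
        Complex.exp (t * α * Complex.I) * (1 - (t : ℂ) ^ 2 * V / 2) * (1 + (t : ℂ) ^ 2 * a x)‖ ≤
      t ^ 2 * (4 * truncatedMoment μ h t + ‖a‖ * |t| * ∫ g, h g ∂μ + ε + t ^ 2 * V * ‖a‖ / 2) := by
  have hsx : StronglyMeasurable fun g => s (g, x) :=
    (by fun_prop : Continuous fun g => s (g, x)).stronglyMeasurable
  have hax : StronglyMeasurable fun g : G => a (g • x) :=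
    (by fun_prop : Continuous fun g : G => a (g • x)).stronglyMeasurable
  have iY : Integrable (fun g => s (g, x) - α) μ :=
    (hh.integrable (by norm_num)).mono' (hsx.sub stronglyMeasurable_const).aestronglyMeasurable
      (ae_of_all _ fun g => hsh g x)
  have is : Integrable (fun g => s (g, x)) μ := by
    refine (iY.add (integrable_const α)).congr (ae_of_all _ fun g => ?_)
    simp
  have hY0 : ∫ g, (s (g, x) - α) ∂μ = 0 := by
    rw [integral_sub is (integrable_const α), hdrift]
    simp
  have key := norm_integral_exp_sub_le (Y := fun g => s (g, x) - α) hh (hsx.sub stronglyMeasurable_const).aestronglyMeasurable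
    (fun g => hsh g x) hY0 hax.aestronglyMeasurable (fun g => a.norm_coe_le_norm (g • x)) t
  rw [← markovOperator_apply μ a x] at key
  have hax' : |a x| ≤ ‖a‖ := a.norm_coe_le_norm x
  set v := ∫ g, (s (g, x) - α) ^ 2 ∂μ
  set J := ∫ g, Complex.exp (t * ((s (g, x) - α : ℝ) : ℂ) * Complex.I) *
    (1 + (t : ℂ) ^ 2 * a (g • x)) ∂μ
  have hJ : twistedAverage μ (fun p => Complex.exp (t * s p * Complex.I))
      (fun y => 1 + (t : ℂ) ^ 2 * a y) x = Complex.exp (t * α * Complex.I) * J := by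
    simp only [twistedAverage, J]
    rw [← integral_const_mul]
    congr 1 with g
    rw [← mul_assoc, ← Complex.exp_add]
    push_cast
    ring_nf
  have hu : ‖Complex.exp (t * α * Complex.I)‖ = 1 := by
    exact_mod_cast Complex.norm_exp_ofReal_mul_I (t * α)
  rw [hJ, mul_assoc (Complex.exp _), ← mul_sub, norm_mul, hu, one_mul]
  -- After the expansion, the t² coefficient is exactly minus the defect of the Poisson equation;
  -- only a t⁴ term is left besides.
  have e : J - (1 - (t : ℂ) ^ 2 * V / 2) * (1 + (t : ℂ) ^ 2 * a x) =
      (J - ((1 + t ^ 2 * markovOperator μ a x - t ^ 2 / 2 * v : ℝ) : ℂ)) +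
      ((t ^ 2 * -(a x - markovOperator μ a x - (-v / 2 - -V / 2)) +
        t ^ 2 * (t ^ 2 * V * a x / 2) : ℝ) : ℂ) := by
    push_cast
    ring
  rw [e]
  refine (norm_add_le _ _).trans ?_
  rw [Complex.norm_real, Real.norm_eq_abs]
  have h1 : |t ^ 2 * -(a x - markovOperator μ a x - (-v / 2 - -V / 2)) +
      t ^ 2 * (t ^ 2 * V * a x / 2)| ≤ t ^ 2 * ε + t ^ 2 * (t ^ 2 * V * ‖a‖ / 2) := by
    refine (abs_add_le _ _).trans (add_le_add ?_ ?_)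
    · rw [abs_mul, abs_neg, abs_of_nonneg (sq_nonneg t)]
      exact mul_le_mul_of_nonneg_left (ha x) (sq_nonneg t)
    · rw [abs_mul, abs_div, abs_mul, abs_of_nonneg (sq_nonneg t),
        abs_of_nonneg (mul_nonneg (sq_nonneg t) hV), abs_two]
      gcongr
  linarith

/-- A bound for the distance between the characteristic function of a cocycle at time `n` and a
power. -/
lemma norm_integral_exp_convPow_sub_le {s : G × X → ℝ} (hs : Continuous s) (hc : IsCocycle s)
    {α : ℝ} {h : G → ℝ} (hh : MemLp h 2 μ) (hsh : ∀ g x, |s (g, x) - α| ≤ h g)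
    (hdrift : ∀ x, ∫ g, s (g, x) ∂μ = α) {V ε : ℝ} (hV : 0 ≤ V) (a : C(X, ℝ))
    (ha : ∀ x, |a x - markovOperator μ a x - (-(∫ g, (s (g, x) - α) ^ 2 ∂μ) / 2 - -V / 2)| ≤ ε)
    {t : ℝ} (ht : t ^ 2 * V / 2 ≤ 1) (n : ℕ) (hn : n * t ^ 2 = 1) (x : X) :
    ‖∫ g, Complex.exp ((t * (s (g, x) - n * α) : ℝ) * Complex.I) ∂(convPow μ n) -
        (1 - (t : ℂ) ^ 2 * V / 2) ^ n‖ ≤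
      (4 * truncatedMoment μ h t + ‖a‖ * |t| * ∫ g, h g ∂μ + ε + t ^ 2 * V * ‖a‖ / 2) +
        2 * (t ^ 2 * ‖a‖) := by
  set χ : G × X → ℂ := fun p => Complex.exp (t * s p * Complex.I)
  set u : X → ℂ := fun y => 1 + (t : ℂ) ^ 2 * a y
  set c : ℂ := 1 - (t : ℂ) ^ 2 * V / 2
  have hexp : ∀ r : ℝ, ‖Complex.exp (r * Complex.I)‖ = 1 := Complex.norm_exp_ofReal_mul_I
  have hχ1 : ∀ p, ‖χ p‖ = 1 := fun p => by
    have := hexp (t * s p)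
    rwa [Complex.ofReal_mul] at this
  have hχc : Continuous χ := by fun_prop
  have hu : Continuous u := by fun_prop
  have hc1 : ‖c‖ ≤ 1 := by
    have : c = ((1 - t ^ 2 * V / 2 : ℝ) : ℂ) := by simp [c]
    rw [this, Complex.norm_real, Real.norm_eq_abs, abs_le]
    have : 0 ≤ t ^ 2 * V / 2 := by positivity
    constructor <;> linarith
  have hu1 : ‖Complex.exp (t * α * Complex.I)‖ = 1 := by
    have := hexp (t * α)
    rwa [Complex.ofReal_mul] at this
  have hs1 : ∀ y, s (1, y) = 0 := fun y => by
    have := hc 1 1 y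
    simpa using this
  have hpow := norm_twistedAverage_convPow_sub_le μ hχc (fun p => (hχ1 p).le)
    (fun g g' y => by
      simp only [χ]
      rw [hc, ← Complex.exp_add]
      push_cast
      ring_nf)
    (fun y => by simp [χ, hs1]) hu
    (c := Complex.exp (t * α * Complex.I) * c)
    (by rw [norm_mul, hu1, one_mul]; exact hc1)
    (norm_twistedAverage_exp_sub_le hs hh hsh hdrift hV a ha t) n x
  rw [← mul_assoc, hn, one_mul] at hpow
  have hub : ∀ y, ‖u y - 1‖ ≤ t ^ 2 * ‖a‖ := fun y => by
    simp only [u, add_sub_cancel_left]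
    rw [norm_mul, norm_pow, Complex.norm_real, Complex.norm_real, Real.norm_eq_abs, sq_abs]
    exact mul_le_mul_of_nonneg_left (a.norm_coe_le_norm y) (sq_nonneg t)
  -- Replacing u by 1 costs t²‖a‖ twice: here under the average, and below at the point x.
  have h1 : ‖twistedAverage (convPow μ n) χ (fun y => u y - 1 * (fun _ => 1) y) x‖ ≤
      t ^ 2 * ‖a‖ :=
    norm_twistedAverage_le _ (fun p => (hχ1 p).le) (fun y => by simpa using hub y) x
  rw [twistedAverage_sub _ hχc (fun p => (hχ1 p).le) hu continuous_const, one_mul] at h1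
  -- This phase recenters by nα and cancels the n-th power of the phase of the eigenvalue.
  set w : ℂ := Complex.exp (((-(t * (n * α)) : ℝ) : ℂ) * Complex.I)
  have hw : ‖w‖ = 1 := hexp _
  have hwc : w * Complex.exp (t * α * Complex.I) ^ n = 1 := by
    rw [← Complex.exp_nat_mul, ← Complex.exp_add]
    push_cast
    ring_nf
    exact Complex.exp_zero
  have hI : ∫ g, Complex.exp ((t * (s (g, x) - n * α) : ℝ) * Complex.I) ∂(convPow μ n) =
      w * twistedAverage (convPow μ n) χ (fun _ => 1) x := by
    simp only [twistedAverage, mul_one, χ, w]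
    rw [← integral_const_mul]
    congr 1 with g
    rw [← Complex.exp_add]
    push_cast
    ring_nf
  have e : w * twistedAverage (convPow μ n) χ (fun _ => 1) x - c ^ n =
      w * (twistedAverage (convPow μ n) χ u x -
        (Complex.exp (t * α * Complex.I) * c) ^ n * u x) -
      w * (twistedAverage (convPow μ n) χ u x - twistedAverage (convPow μ n) χ (fun _ => 1) x) +
      c ^ n * (u x - 1) := by
    rw [mul_pow]
    linear_combination (c ^ n * u x) * hwc
  rw [hI, e]
  have h2 : ‖c ^ n * (u x - 1)‖ ≤ t ^ 2 * ‖a‖ := by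
    rw [norm_mul, norm_pow]
    exact (mul_le_of_le_one_left (norm_nonneg _) (pow_le_one₀ (norm_nonneg _) hc1)).trans (hub x)
  refine (norm_add_le _ _).trans ((add_le_add (norm_sub_le _ _) h2).trans ?_)
  rw [norm_mul, norm_mul, hw, one_mul, one_mul]
  linarith

/-- The central limit theorem for scalar cocycles with constant drift and unique variance, in terms
of characteristic functions and uniformly in the starting point. -/
lemma tendsto_integral_exp_convPow [MeasurableSpace X] [BorelSpace X] [Nonempty X]
    {s : G × X → ℝ} (hs : Continuous s) (hc : IsCocycle s)
    {α : ℝ} {h : G → ℝ} (hh : MemLp h 2 μ) (hsh : ∀ g x, |s (g, x) - α| ≤ h g)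
    (hdrift : ∀ x, ∫ g, s (g, x) ∂μ = α) {V : ℝ}
    (hVν : ∀ ν : Measure X, IsStationary μ ν →
      ∫ p, (s p - α) ^ 2 ∂(μ.prod ν) = V) :
    Tendsto (fun q : ℕ × X => ∫ g, Complex.exp
      (((Real.sqrt q.1)⁻¹ * (s (g, q.2) - q.1 * α) : ℝ) * Complex.I) ∂(convPow μ q.1))
      (atTop ×ˢ ⊤) (𝓝 (Complex.exp (-V / 2))) := by
  obtain ⟨ν₀, hν₀⟩ := exists_isStationary (X := X) μ
  have hV : 0 ≤ V := by
    rw [← hVν ν₀ hν₀]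
    exact integral_nonneg fun p => sq_nonneg _
  have hsq : ∀ g x, (s (g, x) - α) ^ 2 ≤ h g ^ 2 := fun g x => by
    rw [← sq_abs]
    exact pow_le_pow_left₀ (abs_nonneg _) (hsh g x) 2
  have hvc : Continuous fun x => -(∫ g, (s (g, x) - α) ^ 2 ∂μ) / 2 := by
    have : Continuous fun x => ∫ g, (s (g, x) - α) ^ 2 ∂μ := by
      refine continuous_of_dominated (bound := fun g => h g ^ 2) (fun x => ?_)
        (fun x => ae_of_all _ fun g => ?_) hh.integrable_sq (ae_of_all _ fun g => by fun_prop)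
      · exact (by fun_prop : Continuous fun g => (s (g, x) - α) ^ 2).aestronglyMeasurable
      · rw [Real.norm_of_nonneg (sq_nonneg _)]
        exact hsq g x
    fun_prop
  have hmean : ∀ ν : Measure X, IsStationary μ ν →
      ∫ x, (⟨_, hvc⟩ : C(X, ℝ)) x ∂ν = -V / 2 := fun ν hν => by
    have := hν.isProbabilityMeasure
    have hint : Integrable (fun p : G × X => (s p - α) ^ 2) (μ.prod ν) := by
      refine (hh.integrable_sq.comp_fst ν).mono'
        (by fun_prop : Continuous fun p => (s p - α) ^ 2).stronglyMeasurable.aestronglyMeasurable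
        (ae_of_all _ fun p => ?_)
      rw [Real.norm_of_nonneg (sq_nonneg _)]
      exact hsq p.1 p.2
    have e := hVν ν hν
    rw [integral_prod_symm _ hint] at e
    simp only [ContinuousMap.coe_mk]
    rw [integral_div, integral_neg, e]
  rw [Metric.tendsto_nhds]
  intro δ hδ
  -- The function a is fixed before n grows: the Poisson error contributes δ/2 for every n, and all
  -- terms involving ‖a‖ vanish as t → 0.
  obtain ⟨a, ha⟩ := exists_approx_poisson μ ⟨_, hvc⟩ (-V / 2) hmean (half_pos hδ)
  have ht : Tendsto (fun n : ℕ => (Real.sqrt n)⁻¹) atTop (𝓝 0) :=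
    (Real.tendsto_sqrt_atTop.comp tendsto_natCast_atTop_atTop).inv_tendsto_atTop
  have ht2 : Tendsto (fun n : ℕ => (Real.sqrt n)⁻¹ ^ 2) atTop (𝓝 0) := by
    simpa using ht.pow 2
  have h0 : ∀ g, 0 ≤ h g := fun g => (abs_nonneg _).trans (hsh g (Classical.arbitrary X))
  have hlim : Tendsto (fun n : ℕ => (4 * truncatedMoment μ h (Real.sqrt n)⁻¹ +
      ‖a‖ * |(Real.sqrt n)⁻¹| * ∫ g, h g ∂μ + δ / 2 + (Real.sqrt n)⁻¹ ^ 2 * V * ‖a‖ / 2) +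
        2 * ((Real.sqrt n)⁻¹ ^ 2 * ‖a‖) +
      ‖(1 + (-V / 2 : ℂ) / n) ^ n - Complex.exp (-V / 2)‖) atTop (𝓝 (δ / 2)) := by
    have l1 := (tendsto_truncatedMoment hh h0 ht).const_mul 4
    have l2 := (ht.abs.const_mul ‖a‖).mul_const (∫ g, h g ∂μ)
    have l3 := ((ht2.mul_const V).mul_const ‖a‖).div_const 2
    have l4 := (ht2.mul_const ‖a‖).const_mul 2
    have l5 := ((Complex.tendsto_one_add_div_pow_exp (-V / 2 : ℂ)).sub_const
      (Complex.exp (-V / 2))).norm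
    simpa using ((((l1.add l2).add_const (δ / 2)).add l3).add l4).add l5
  have hV2 : ∀ᶠ n : ℕ in atTop, (Real.sqrt n)⁻¹ ^ 2 * V / 2 < 1 := by
    have := (ht2.mul_const V).div_const 2
    rw [zero_mul, zero_div] at this
    exact this.eventually (gt_mem_nhds zero_lt_one)
  -- Positivity of n is needed for n t² = 1, since the inverse of √0 is 0.
  have hev := (hlim.eventually (gt_mem_nhds (half_lt_self hδ))).and
    (hV2.and (eventually_gt_atTop 0))
  filter_upwards [tendsto_fst.eventually hev] with q ⟨hq1, hq2, hq3⟩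
  have hq0 : (0 : ℝ) < q.1 := Nat.cast_pos.2 hq3
  have hsq2 : (Real.sqrt q.1)⁻¹ ^ 2 = (q.1 : ℝ)⁻¹ := by
    rw [inv_pow, Real.sq_sqrt hq0.le]
  have hb := norm_integral_exp_convPow_sub_le hs hc hh hsh hdrift hV a ha hq2.le q.1
    (by rw [hsq2]; exact mul_inv_cancel₀ hq0.ne') q.2
  have he : (1 - (((Real.sqrt q.1)⁻¹ : ℝ) : ℂ) ^ 2 * V / 2) = 1 + (-V / 2 : ℂ) / q.1 := by
    rw [← Complex.ofReal_pow, hsq2]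
    push_cast
    ring
  rw [he] at hb
  rw [dist_eq_norm]
  refine lt_of_le_of_lt ?_ hq1
  exact (norm_sub_le_norm_sub_add_norm_sub _ _ _).trans (add_le_add_left hb _)

end ScalarCocycle

/-! ### Gaussian laws and Lévy continuity in finite dimension -/

section GaussianLaw

variable {E : Type*} [NormedAddCommGroup E] [NormedSpace ℝ E] [FiniteDimensional ℝ E]
  [MeasurableSpace E] [BorelSpace E]

/-- Every nonnegative symmetric `2`-tensor is the covariance of a centered Gaussian law. -/
lemma exists_isGaussianLaw (Φ : QuadraticForm ℝ (StrongDual ℝ E)) (hΦ : ∀ f, 0 ≤ Φ f) :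
    ∃ N : Measure E, IsGaussianLaw N Φ := by
  classical
  let ι := Fin (Module.finrank ℝ E)
  let e : E ≃L[ℝ] EuclideanSpace ℝ ι := toEuclidean
  -- Euclidean coordinates identify vectors with functionals on E, so that Φ becomes a positive
  -- semidefinite matrix S.
  let D : (ι → ℝ) →ₗ[ℝ] StrongDual ℝ E :=
    { toFun := fun x => (innerSL ℝ (WithLp.toLp 2 x)).comp (e : E →L[ℝ] EuclideanSpace ℝ ι)
      map_add' := fun x y => by ext v; simp
      map_smul' := fun c x => by ext v; simp }
  let Q : QuadraticForm ℝ (ι → ℝ) := Φ.comp D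
  let S : Matrix ι ι ℝ := QuadraticForm.toMatrix' Q
  have hS : ∀ x : ι → ℝ, x ⬝ᵥ S.mulVec x = Φ (D x) := fun x => by
    rw [← Matrix.toLinearMap₂'_apply']
    simp only [S, QuadraticForm.toMatrix', Matrix.toLinearMap₂'_toMatrix']
    exact QuadraticMap.associated_eq_self_apply ℝ Q x
  have hSpos : S.PosSemidef := by
    refine Matrix.PosSemidef.of_dotProduct_mulVec_nonneg ?_ fun x => ?_
    · exact QuadraticForm.isSymm_toMatrix' Q
    · have : star x = x := by ext; simp
      rw [this, hS]
      exact hΦ _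
  set γ := multivariateGaussian (0 : EuclideanSpace ℝ ι) S
  have hmeas : Measurable e.symm := e.symm.continuous.measurable
  have hN : IsGaussian (γ.map e.symm) := by
    have := isGaussian_map_of_measurable (μ := γ)
      (L := (e.symm : EuclideanSpace ℝ ι →L[ℝ] E)) hmeas
    exact this
  refine ⟨γ.map e.symm, hN, ?_, fun f => ⟨?_, ?_⟩⟩
  · rw [integral_map hmeas.aemeasurable (by fun_prop)]
    have := (e.symm : EuclideanSpace ℝ ι →L[ℝ] E).integral_comp_comm
      (IsGaussian.integrable_fun_id (μ := γ))
    rw [integral_id_multivariateGaussian] at this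
    simpa using this
  · exact (IsGaussian.memLp_dual (γ.map e.symm) f 2 (by simp)).integrable_sq
  -- The Riesz vector of f in these coordinates, for which Φ f is the value of the quadratic form of
  -- S at z.
  · let z : EuclideanSpace ℝ ι := (InnerProductSpace.toDual ℝ _).symm
      (f.comp (e.symm : EuclideanSpace ℝ ι →L[ℝ] E))
    have hz : ∀ y, f (e.symm y) = inner ℝ z y := fun y => by simp [z]
    have hDz : D z.ofLp = f := by
      ext v
      have := hz (e v)
      rw [e.symm_apply_apply] at this
      simp [D, this]
    have hcov := covarianceBilin_multivariateGaussian (μ := 0) hSpos z z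
    rw [hS, hDz, covarianceBilin_apply IsGaussian.memLp_two_id] at hcov
    rw [integral_map hmeas.aemeasurable (by fun_prop), ← hcov]
    have h0 : ∫ x, id x ∂γ = 0 := integral_id_multivariateGaussian
    congr 1 with y
    rw [h0, sub_zero, hz, sq]

lemma IsGaussianLaw.charFunDual_eq {N : Measure E} {Φ : QuadraticForm ℝ (StrongDual ℝ E)}
    (h : IsGaussianLaw N Φ) (f : StrongDual ℝ E) :
    charFunDual N f = Complex.exp (-(Φ f : ℂ) / 2) := by
  have := h.isGaussian
  have hm : ∫ v, f v ∂N = 0 := by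
    rw [f.integral_comp_comm IsGaussian.integrable_fun_id, h.mean_eq_zero, map_zero]
  rw [IsGaussian.charFunDual_eq, variance_of_integral_eq_zero (by fun_prop) hm, integral_complex_ofReal, hm,
    (h.covariance_eq f).2]
  congr 1
  push_cast
  ring

/-- Lévy's continuity theorem on a finite-dimensional normed space, along a countably generated
filter. -/
lemma tendsto_integral_of_tendsto_charFunDual {ι : Type*} {l : Filter ι} [l.IsCountablyGenerated]
    {P : ι → Measure E} [∀ i, IsProbabilityMeasure (P i)] {N : Measure E} [IsProbabilityMeasure N]
    (h : ∀ f : StrongDual ℝ E, Tendsto (fun i => charFunDual (P i) f) l (𝓝 (charFunDual N f)))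
    (ψ : E →ᵇ ℝ) : Tendsto (fun i => ∫ v, ψ v ∂(P i)) l (𝓝 (∫ v, ψ v ∂N)) := by
  -- Countable generation reduces the filter to sequences, where Lévy's theorem is used.
  refine tendsto_of_seq_tendsto fun k hk => ?_
  let e : E ≃L[ℝ] EuclideanSpace ℝ (Fin (Module.finrank ℝ E)) := toEuclidean
  have hm : Measurable e := e.continuous.measurable
  have hp : ∀ (κ : Measure E) [IsProbabilityMeasure κ], IsProbabilityMeasure (κ.map e) :=
    fun κ _ => Measure.isProbabilityMeasure_map hm.aemeasurable
  have hcf : ∀ (κ : Measure E) t, charFun (κ.map e) t =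
      charFunDual κ ((InnerProductSpace.toDualMap ℝ _ t).comp
        (e : E →L[ℝ] EuclideanSpace ℝ (Fin (Module.finrank ℝ E)))) := fun κ t => by
    rw [charFun_eq_charFunDual_toDualMap]
    exact charFunDual_map (e : E →L[ℝ] EuclideanSpace ℝ (Fin (Module.finrank ℝ E))) _
  have hint : ∀ κ : Measure E, ∫ y, ψ (e.symm y) ∂(κ.map e) = ∫ v, ψ v ∂κ := fun κ => by
    rw [integral_map hm.aemeasurable (by fun_prop)]
    simp
  have key := ProbabilityMeasure.tendsto_of_tendsto_charFun
    (μ := fun n => ⟨(P (k n)).map e, hp _⟩) (μ₀ := ⟨N.map e, hp _⟩) fun t => by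
      simp only [ProbabilityMeasure.coe_mk, hcf]
      exact (h _).comp hk
  have := ProbabilityMeasure.tendsto_iff_forall_integral_tendsto.1 key
    (ψ.compContinuous ⟨e.symm, e.symm.continuous⟩)
  simpa [hint, Function.comp_def] using this

end GaussianLaw

/-! ### Sup-norm bounds -/

section Norms

variable {G X E : Type*} [TopologicalSpace G] [TopologicalSpace X] [CompactSpace X]
  [NormedAddCommGroup E] {σ : G × X → E}

/-- Compactness of X bounds the family; an unbounded real supremum would take the default value 0.
-/
lemma norm_le_supNorm (hσ : Continuous σ) (g : G) (x : X) : ‖σ (g, x)‖ ≤ supNorm σ g :=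
  le_ciSup (f := fun x => ‖σ (g, x)‖)
    (isCompact_range (by fun_prop : Continuous fun x => ‖σ (g, x)‖)).bddAbove x

-- Measurability of the supremum is recovered as that of the square root of its integrable square.
omit [TopologicalSpace G] [TopologicalSpace X] [CompactSpace X] in
lemma memLp_supNorm [MeasurableSpace G] {μ : Measure G}
    (h : Integrable (fun g => supNorm σ g ^ 2) μ) : MemLp (supNorm σ) 2 μ := by
  have h0 : ∀ g, 0 ≤ supNorm σ g := fun g => Real.iSup_nonneg fun x => norm_nonneg _
  have hm : AEStronglyMeasurable (supNorm σ) μ :=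
    (Real.continuous_sqrt.comp_aestronglyMeasurable h.aestronglyMeasurable).congr
      (ae_of_all _ fun g => Real.sqrt_sq (h0 g))
  exact (memLp_two_iff_integrable_sq hm).2 h

lemma norm_exp_mul_I_sub_exp_mul_I_le (a b : ℝ) :
    ‖Complex.exp (a * Complex.I) - Complex.exp (b * Complex.I)‖ ≤ |a - b| := by
  have e : Complex.exp (a * Complex.I) - Complex.exp (b * Complex.I) =
      Complex.exp (b * Complex.I) * (Complex.exp (Complex.I * ((a - b : ℝ) : ℂ)) - 1) := by
    rw [mul_sub, ← Complex.exp_add]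
    push_cast
    ring_nf
  rw [e, norm_mul, Complex.norm_exp_ofReal_mul_I, one_mul]
  exact Real.norm_exp_I_mul_ofReal_sub_one_le

end Norms

/-! ### From constant drift to centerable cocycles -/

section Centered

variable {G X E : Type*} [Group G] [TopologicalSpace G] [IsTopologicalGroup G]
  [SecondCountableTopology G] [MeasurableSpace G] [BorelSpace G]
  [TopologicalSpace X] [CompactSpace X] [TopologicalSpace.MetrizableSpace X] [Nonempty X]
  [MeasurableSpace X] [BorelSpace X] [MulAction G X] [ContinuousSMul G X]
  [NormedAddCommGroup E] [NormedSpace ℝ E] [FiniteDimensional ℝ E]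
  {μ : Measure G} [IsProbabilityMeasure μ] {σ σ₀ : G × X → E} {φ : X → E} {m : E}
  {Φ : QuadraticForm ℝ (StrongDual ℝ E)}

-- `IsCentering` does not ask for continuity of σ₀; it follows from that of σ and of the transfer
-- function.
omit [IsTopologicalGroup G] [SecondCountableTopology G] [BorelSpace G] [CompactSpace X]
  [TopologicalSpace.MetrizableSpace X] [Nonempty X] [MeasurableSpace X] [BorelSpace X]
  [FiniteDimensional ℝ E] [IsProbabilityMeasure μ] in
lemma IsCentering.continuous (h : IsCentering μ σ σ₀ φ m) (hσ : Continuous σ) :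
    Continuous σ₀ := by
  have e : σ₀ = fun p => σ p - (φ p.2 - φ (p.1 • p.2)) := by
    ext p
    rw [h.eq_add_coboundary, add_sub_cancel_right]
  have := h.continuous_transfer
  rw [e]
  fun_prop

/-- The central limit theorem for `f ∘ σ₀`, with `σ₀` of constant drift. -/
lemma IsCentering.tendsto_integral_exp_drift (h : IsCentering μ σ σ₀ φ m) (hσ : Continuous σ)
    (hσ_sup : Integrable (fun g => supNorm σ g ^ 2) μ)
    (hΦ : ∀ ν : Measure X, IsStationary μ ν → HasSecondMoment (μ.prod ν) (fun p => σ₀ p - m) Φ)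
    (f : StrongDual ℝ E) :
    Tendsto (fun q : ℕ × X => ∫ g, Complex.exp
      (((Real.sqrt q.1)⁻¹ * (f (σ₀ (g, q.2)) - q.1 * f m) : ℝ) * Complex.I) ∂(convPow μ q.1))
      (atTop ×ˢ ⊤) (𝓝 (Complex.exp (-(Φ f : ℂ) / 2))) := by
  have hσ₀ := h.continuous hσ
  obtain ⟨K, hK⟩ := isCompact_univ.exists_bound_of_continuousOn h.continuous_transfer.continuousOn
  have hb : ∀ g x, ‖σ₀ (g, x)‖ ≤ supNorm σ g + 2 * K := fun g x => by
    have e : σ₀ (g, x) = σ (g, x) - (φ x - φ (g • x)) := by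
      rw [h.eq_add_coboundary, add_sub_cancel_right]
    rw [e]
    refine (norm_sub_le _ _).trans (add_le_add (norm_le_supNorm hσ g x)
      ((norm_sub_le _ _).trans ?_))
    linarith [hK x trivial, hK (g • x) trivial]
  have hL := memLp_supNorm hσ_sup
  have hLp : MemLp (fun g => ‖f‖ * (supNorm σ g + (2 * K + ‖m‖))) 2 μ :=
    (hL.add (memLp_const _)).const_mul _
  refine tendsto_integral_exp_convPow (s := fun p => f (σ₀ p)) (by fun_prop)
    (fun g g' x => by simp only [h.isCocycle g g' x, map_add]) hLp (fun g x => ?_) (fun x => ?_)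
    fun ν hν => ?_
  · rw [← map_sub]
    refine (f.le_opNorm _).trans (mul_le_mul_of_nonneg_left ?_ (norm_nonneg f))
    linarith [norm_sub_le (σ₀ (g, x)) m, hb g x]
  · have hi : Integrable (fun g => σ₀ (g, x)) μ :=
      ((hL.integrable (by norm_num)).add (integrable_const (2 * K))).mono'
        (by fun_prop : Continuous fun g => σ₀ (g, x)).aestronglyMeasurable
        (ae_of_all _ fun g => hb g x)
    rw [f.integral_comp_comm hi, h.drift_eq]
  · rw [← (hΦ ν hν f).2]
    simp only [map_sub]

/-- The central limit theorem for `f ∘ σ`, with `σ` centerable. -/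
lemma IsCentering.tendsto_integral_exp (h : IsCentering μ σ σ₀ φ m) (hσ : Continuous σ)
    (hσ_sup : Integrable (fun g => supNorm σ g ^ 2) μ)
    (hΦ : ∀ ν : Measure X, IsStationary μ ν → HasSecondMoment (μ.prod ν) (fun p => σ₀ p - m) Φ)
    (f : StrongDual ℝ E) :
    Tendsto (fun q : ℕ × X => ∫ g, Complex.exp
      (((Real.sqrt q.1)⁻¹ * (f (σ (g, q.2)) - q.1 * f m) : ℝ) * Complex.I) ∂(convPow μ q.1))
      (atTop ×ˢ ⊤) (𝓝 (Complex.exp (-(Φ f : ℂ) / 2))) := by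
  have hσ₀ := h.continuous hσ
  obtain ⟨K, hK⟩ := isCompact_univ.exists_bound_of_continuousOn h.continuous_transfer.continuousOn
  have hd : ∀ g x, |f (σ (g, x)) - f (σ₀ (g, x))| ≤ ‖f‖ * (2 * K) := fun g x => by
    rw [← map_sub, h.eq_add_coboundary, add_sub_cancel_left]
    refine (f.le_opNorm _).trans (mul_le_mul_of_nonneg_left ?_ (norm_nonneg f))
    linarith [norm_sub_le (φ x) (φ (g • x)), hK x trivial, hK (g • x) trivial]
  have hint : ∀ {τ : G × X → E}, Continuous τ → ∀ q : ℕ × X, Integrable (fun g => Complex.exp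
      (((Real.sqrt q.1)⁻¹ * (f (τ (g, q.2)) - q.1 * f m) : ℝ) * Complex.I)) (convPow μ q.1) :=
    fun {τ} hτ q => by
      refine Integrable.of_bound (C := 1) ?_
        (ae_of_all _ fun g => (Complex.norm_exp_ofReal_mul_I _).le)
      exact (by fun_prop : Continuous fun g => Complex.exp
        (((Real.sqrt q.1)⁻¹ * (f (τ (g, q.2)) - q.1 * f m) : ℝ) * Complex.I)).aestronglyMeasurable
  have hlim : Tendsto (fun n : ℕ => (Real.sqrt n)⁻¹ * (‖f‖ * (2 * K))) atTop (𝓝 0) := by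
    have := (Real.tendsto_sqrt_atTop.comp
      tendsto_natCast_atTop_atTop).inv_tendsto_atTop.mul_const (‖f‖ * (2 * K))
    rw [zero_mul] at this
    exact this
  -- The bounded coboundary shifts the phases by at most ‖f‖·2K/√n, uniformly in the starting point.
  have hdiff := squeeze_zero_norm (fun q : ℕ × X => ?_) (hlim.comp
    (tendsto_fst (f := atTop) (g := (⊤ : Filter X))))
    (f := fun q : ℕ × X => ∫ g, (Complex.exp
        (((Real.sqrt q.1)⁻¹ * (f (σ (g, q.2)) - q.1 * f m) : ℝ) * Complex.I) - Complex.exp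
        (((Real.sqrt q.1)⁻¹ * (f (σ₀ (g, q.2)) - q.1 * f m) : ℝ) * Complex.I)) ∂(convPow μ q.1))
  · have := hdiff.add (h.tendsto_integral_exp_drift hσ hσ_sup hΦ f)
    rw [zero_add] at this
    refine this.congr fun q => ?_
    rw [integral_sub (hint hσ q) (hint hσ₀ q), sub_add_cancel]
  · refine (norm_integral_le_of_norm_le_const (C := (Real.sqrt q.1)⁻¹ * (‖f‖ * (2 * K)))
      (ae_of_all _ fun g => ?_)).trans (by simp)
    refine (norm_exp_mul_I_sub_exp_mul_I_le _ _).trans ?_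
    rw [← mul_sub, sub_sub_sub_cancel_right, abs_mul, abs_of_nonneg (by positivity)]
    exact mul_le_mul_of_nonneg_left (hd g q.2) (by positivity)

end Centered

end CocycleCLT

/-! ### The main theorem -/

theorem theorem3p4 {G X E : Type*}
    [Group G] [TopologicalSpace G] [IsTopologicalGroup G] [LocallyCompactSpace G]
    [SecondCountableTopology G] [MeasurableSpace G] [BorelSpace G]
    [TopologicalSpace X] [CompactSpace X] [TopologicalSpace.MetrizableSpace X] [Nonempty X]
    [MeasurableSpace X] [BorelSpace X] [MulAction G X] [ContinuousSMul G X]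
    [NormedAddCommGroup E] [NormedSpace ℝ E] [FiniteDimensional ℝ E]
    [MeasurableSpace E] [BorelSpace E]
    (μ : Measure G) [IsProbabilityMeasure μ]
    (σ : G × X → E) (hσ_cont : Continuous σ) (hσ : CocycleCLT.IsCocycle σ)
    (hσ_sup : Integrable (fun g => CocycleCLT.supNorm σ g ^ 2) μ)
    (m : E) (Φ : QuadraticForm ℝ (StrongDual ℝ E))
    (hσ_cov : CocycleCLT.IsCenterableWithUniqueCovariance μ σ m Φ) :
    ∃ N : Measure E, CocycleCLT.IsGaussianLaw N Φ ∧
      ∀ ψ : E →ᵇ ℝ,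
        TendstoUniformly
          (fun (n : ℕ) (x : X) =>
            ∫ g, ψ ((Real.sqrt n)⁻¹ • (σ (g, x) - (n : ℝ) • m)) ∂(CocycleCLT.convPow μ n))
          (fun _ : X => ∫ v, ψ v ∂N) atTop := by
  obtain ⟨σ₀, φ, hcent, hcov⟩ := hσ_cov
  obtain ⟨ν, hν⟩ := CocycleCLT.exists_isStationary (X := X) μ
  obtain ⟨N, hN⟩ := CocycleCLT.exists_isGaussianLaw Φ fun f => by
    rw [← (hcov ν hν f).2]
    exact integral_nonneg fun p => sq_nonneg _
  refine ⟨N, hN, fun ψ => ?_⟩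
  have := hN.isGaussian
  let T : ℕ × X → G → E := fun q g => (Real.sqrt q.1)⁻¹ • (σ (g, q.2) - (q.1 : ℝ) • m)
  have hT : ∀ q, Measurable (T q) := fun q => (by fun_prop : Continuous (T q)).measurable
  have hP : ∀ q : ℕ × X, IsProbabilityMeasure ((CocycleCLT.convPow μ q.1).map (T q)) :=
    fun q => Measure.isProbabilityMeasure_map (hT q).aemeasurable
  have key := CocycleCLT.tendsto_integral_of_tendsto_charFunDual (l := atTop ×ˢ (⊤ : Filter X))
    (P := fun q => (CocycleCLT.convPow μ q.1).map (T q)) (N := N) (fun f => ?_) ψ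
  · rw [Metric.tendstoUniformly_iff]
    intro ε hε
    -- Currying an eventuality along `atTop ×ˢ ⊤` yields, for all large n, a bound at every x.
    have := (key.eventually (Metric.ball_mem_nhds _ hε)).curry
    filter_upwards [this] with n hn x
    have := eventually_top.1 hn x
    rw [integral_map (hT _).aemeasurable (by fun_prop)] at this
    rw [dist_comm]
    exact this
  · rw [hN.charFunDual_eq]
    refine (hcent.tendsto_integral_exp hσ_cont hσ_sup hcov f).congr fun q => ?_
    rw [charFunDual_apply, integral_map (hT q).aemeasurable (by fun_prop)]
    simp [T]
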